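/- All graphs are finite and simple and have at least one vertex. For a graph $G$ let $n(G)$ be its number of vertices and $d(G)=\frac1{n(G)}\sum_{v}\deg(v)$ its average degree. For an integer $k\ge 0$, a set $S$ of vertices of $G$ is $k$-independent if the subgraph of $G$ induced by $S$ has maximum degree at most $k$, and $\alpha_k(G)$ is the maximum cardinality of a $k$-independent set of $G$. For integers $k,d\ge 0$ let $$f(k,d)=\inf\left\{\frac{\alpha_k(G)}{n(G)} : G \text{ a graph with } d(G)\le d\right\},$$ and for an integer $r\ge 3$ let $h(r)=\frac{(r-1)^{r+3}-1}{r-2}$. **Theorem.** Let $d,k\ge 0$ be integers. 1. If $d\ge k$, then $\frac{k+1}{d+k+1}\le f(k,d)\le\frac{k+1}{d+1}$. 2. If $d>k$, $d$ is even and $k$ is odd, then $f(k,d)\le\frac{k+1}{d+2}$. 3. If $d>k$, then $f(k,d)\le\frac{k+2}{d+3}$. 4. If $k\ge 3$, $d\ge 2h(k)-k-1$ and $d+k+1$ is even, then $f(k,d)\le\frac{k+2}{d+k+1}$. 5. If $q\ge 0$ is an integer and $2\le d\le 4+6q$, then $\frac{3}{d+3}\le f(2,d)\le\frac{3}{d+1+\frac1{q+1}}$.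 6. If $k\ge 2$, then $\frac{k}{k+1}\le f(k,2)\le\frac{k+1}{k+2+\frac1{k+1}}$. 7. For every $k\ge 3$ there is a constant $c>0$ (which may depend on $k$ but not on $d$) such that, for all integers $d\ge 0$, $f(k,d)<\frac{k+2}{d+c\left(\frac d2\right)^{\frac1{k+2}}+1}$. -/

import Mathlib

noncomputable section

namespace KIndependence

open Classical in
/-- The average degree `d(G) = (1 / n(G)) * ∑ v, deg v` of a finite graph. -/
def avgDegree {V : Type*} [Fintype V] (G : SimpleGraph V) : ℝ :=
  (∑ v : V, (G.degree v : ℝ)) / (Fintype.card V : ℝ)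

open Classical in
/-- `S` is a `k`-independent set of `G`: the subgraph of `G` induced by `S` has maximum degree
at most `k` (the maximum degree of the graph without vertices being `0`). -/
def IsKIndep {V : Type*} [Fintype V] (G : SimpleGraph V) (k : ℕ) (S : Finset V) : Prop :=
  (G.induce (S : Set V)).maxDegree ≤ k

open Classical in
/-- The `k`-independence number `α_k(G)`: the maximum cardinality of a `k`-independent set. -/
def kIndepNum {V : Type*} [Fintype V] (G : SimpleGraph V) (k : ℕ) : ℕ :=
  (Finset.univ.filter fun S : Finset V => IsKIndep G k S).sup Finset.card

/-- All values `α_k(G) / n(G)`, for `G` a finite graph with at least one vertex and with average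
degree at most `d`. -/
def ratioSet (k d : ℕ) : Set ℝ :=
  {x | ∃ (V : Type) (_ : Fintype V) (_ : Nonempty V) (G : SimpleGraph V),
    avgDegree G ≤ (d : ℝ) ∧ x = (kIndepNum G k : ℝ) / (Fintype.card V : ℝ)}

/-- `f(k, d) = inf {α_k(G) / n(G) : d(G) ≤ d}`; a set of nonnegative reals that contains `1`. -/
def f (k d : ℕ) : ℝ := sInf (ratioSet k d)

/-- `h(r) = ((r - 1)^(r + 3) - 1) / (r - 2)`, used for `r ≥ 3`. -/
def h (r : ℕ) : ℝ := (((r : ℝ) - 1) ^ (r + 3) - 1) / ((r : ℝ) - 2)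

end KIndependence

end

noncomputable section

namespace KIndependence

open Finset SimpleGraph
open scoped Classical

/-! ### Degrees inside a vertex set, and reductions for bounding `f` -/

variable {V : Type*}

/-! Lower bounds. Put x = d/(k+1). For each integer t ≥ 1 the line through (t-1, 1/t) and (t,
1/(t+1)), a chord of 1/(x+1), bounds the ratio from below (`exists_kIndep`). A vertex of degree at
least (k+1)t can be deleted without loss. Once there is none, Lovász's partition splits the graph
into t classes of inner degree at most k, and the largest is a good set unless the average degree is
so small that the chord for t-1 is better. By convexity the chord over x lies above 1/(x+1) =
(k+1)/(d+k+1).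

Upper bounds (2), (3), (4), (7) use the complement of an r-regular graph H on d+r+1 vertices, which
is d-regular. A set of a+1 vertices is k-independent there exactly when H induces minimum degree at
least a-k on it (`f_le_of_regular`). For a = k+1 and H a perfect matching, parity excludes such
sets; for a = k+2 they contain a cycle of H, which is excluded when H is one long cycle or has girth
greater than k+3. Regular graphs of large girth come from the Erdős–Sachs switching argument
(`exists_regular_girthGT`); for (7) the degree r grows like a (k+2)-th root of d.

The other upper bounds use complete graphs, and disjoint unions of joins of a clique with k+1
isolated vertices, mixed so that the average degree is at most d. -/

/-- The number of neighbours of `v` in `U`. -/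
def degIn (G : SimpleGraph V) (U : Finset V) (v : V) : ℕ := #{w ∈ U | G.Adj v w}

lemma exists_card_eq_degIn (G : SimpleGraph V) (U : Finset V) (v : V) :
    ∃ T : Finset V, degIn G U v = #T ∧ ∀ w, w ∈ T ↔ w ∈ U ∧ G.Adj v w :=
  ⟨_, rfl, fun _ => mem_filter⟩

lemma degIn_eq_card (G : SimpleGraph V) (U : Finset V) (v : V) (T : Finset V)
    (h : ∀ w, w ∈ T ↔ w ∈ U ∧ G.Adj v w) : degIn G U v = #T := by
  obtain ⟨T', h1, h2⟩ := exists_card_eq_degIn G U v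
  rw [h1]
  congr 1
  ext w
  rw [h, h2]

lemma degIn_mono (G : SimpleGraph V) {S U : Finset V} (h : S ⊆ U) (v : V) :
    degIn G S v ≤ degIn G U v :=
  card_le_card (filter_subset_filter _ h)

lemma isKIndep_iff [Fintype V] (G : SimpleGraph V) (k : ℕ) (S : Finset V) :
    IsKIndep G k S ↔ ∀ v ∈ S, degIn G S v ≤ k := by
  have key : ∀ v : (S : Set V), (G.induce (S : Set V)).degree v = degIn G S v := by
    intro v
    rw [← card_neighborFinset_eq_degree, degIn, ← card_map (Function.Embedding.subtype _)]
    congr 1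
    ext w
    simp only [mem_map, mem_neighborFinset, comap_adj, Function.Embedding.subtype_apply,
      Subtype.exists, mem_filter]
    constructor
    · rintro ⟨a, ha, h, rfl⟩
      exact ⟨ha, h⟩
    · rintro ⟨ha, h⟩
      exact ⟨w, ha, h, rfl⟩
  unfold IsKIndep
  constructor
  · intro h v hv
    have := (degree_le_maxDegree (G.induce (S : Set V)) ⟨v, hv⟩).trans h
    rwa [key] at this
  · intro h
    refine maxDegree_le_of_forall_degree_le _ _ fun v => ?_
    rw [key]
    exact h v v.2

lemma kIndepNum_le [Fintype V] {G : SimpleGraph V} {k a : ℕ}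
    (h : ∀ S : Finset V, (∀ v ∈ S, degIn G S v ≤ k) → #S ≤ a) : kIndepNum G k ≤ a :=
  Finset.sup_le fun S hS => h S ((isKIndep_iff G k S).1 (mem_filter.1 hS).2)

lemma card_le_kIndepNum [Fintype V] {G : SimpleGraph V} {k : ℕ} {S : Finset V}
    (h : ∀ v ∈ S, degIn G S v ≤ k) : #S ≤ kIndepNum G k :=
  Finset.le_sup (f := Finset.card) (mem_filter.2 ⟨mem_univ _, (isKIndep_iff G k S).2 h⟩)

lemma bddBelow_ratioSet (k d : ℕ) : BddBelow (ratioSet k d) :=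
  ⟨0, by rintro x ⟨V, _, _, G, -, rfl⟩; positivity⟩

lemma f_le {V : Type} [Fintype V] [Nonempty V] (G : SimpleGraph V) {k d a : ℕ}
    (hd : ∑ v, degIn G univ v ≤ d * Fintype.card V)
    (h : ∀ S : Finset V, (∀ v ∈ S, degIn G S v ≤ k) → #S ≤ a) :
    f k d ≤ (a : ℝ) / Fintype.card V := by
  have hc : (0 : ℝ) < Fintype.card V := by exact_mod_cast Fintype.card_pos
  refine (csInf_le (bddBelow_ratioSet k d) ⟨V, inferInstance, inferInstance, G, ?_, rfl⟩).trans ?_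
  · rw [avgDegree, div_le_iff₀ hc]
    have : ∀ v, G.degree v = degIn G univ v := fun v => by
      rw [← card_neighborFinset_eq_degree, neighborFinset_eq_filter, degIn]
    simp only [this]
    exact_mod_cast hd
  · gcongr
    exact kIndepNum_le h

lemma le_f {k d : ℕ} {x : ℝ} (h : ∀ (V : Type) [Fintype V] [Nonempty V] (G : SimpleGraph V),
    ∑ v, degIn G univ v ≤ d * Fintype.card V →
    ∃ S : Finset V, (∀ v ∈ S, degIn G S v ≤ k) ∧ x * Fintype.card V ≤ #S) :
    x ≤ f k d := by
  refine le_csInf ⟨_, PUnit, inferInstance, inferInstance, ⊥, by simp [avgDegree], rfl⟩ ?_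
  rintro _ ⟨V, i1, i2, G, hG, rfl⟩
  have hc : (0 : ℝ) < Fintype.card V := by exact_mod_cast Fintype.card_pos
  rw [avgDegree, div_le_iff₀ hc] at hG
  have : ∀ v, G.degree v = degIn G univ v := fun v => by
    rw [← card_neighborFinset_eq_degree, neighborFinset_eq_filter, degIn]
  simp only [this] at hG
  obtain ⟨S, hS, hx⟩ := h V G (by exact_mod_cast hG)
  rw [le_div_iff₀ hc]
  exact hx.trans (by exact_mod_cast card_le_kIndepNum hS)

lemma degIn_erase_self (G : SimpleGraph V) (U : Finset V) (v : V) :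
    degIn G (U.erase v) v = degIn G U v := by
  unfold degIn
  congr 1
  ext w
  simp only [mem_filter, mem_erase]
  constructor
  · rintro ⟨⟨-, h⟩, h'⟩; exact ⟨h, h'⟩
  · rintro ⟨h, h'⟩; exact ⟨⟨h'.ne', h⟩, h'⟩

lemma degIn_eq_erase_add (G : SimpleGraph V) {U : Finset V} {v : V} (hv : v ∈ U) (x : V) :
    degIn G U x = degIn G (U.erase v) x + if G.Adj v x then 1 else 0 := by
  unfold degIn
  conv_lhs => rw [← insert_erase hv, filter_insert]
  by_cases h : G.Adj v x
  · rw [if_pos h.symm, if_pos h, card_insert_of_notMem (by simp)]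
  · rw [if_neg (fun h' => h h'.symm), if_neg h, add_zero]

/-- Each edge at `v` counts once at `v` and once at its other end. Degree sums stand in for twice
the number of edges throughout. -/
lemma sum_degIn_erase (G : SimpleGraph V) {U : Finset V} {v : V} (hv : v ∈ U) :
    ∑ x ∈ U, degIn G U x = ∑ x ∈ U.erase v, degIn G (U.erase v) x + 2 * degIn G U v := by
  rw [← add_sum_erase U _ hv, sum_congr rfl fun x _ => degIn_eq_erase_add G hv x,
    sum_add_distrib, ← card_filter]
  have : #{x ∈ U.erase v | G.Adj v x} = degIn G U v := degIn_erase_self G U v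
  omega

lemma even_sum_degIn (G : SimpleGraph V) (U : Finset V) : Even (∑ v ∈ U, degIn G U v) := by
  induction U using Finset.strongInduction with
  | H U ih =>
  obtain rfl | ⟨v, hv⟩ := U.eq_empty_or_nonempty
  · simp
  · rw [sum_degIn_erase G hv]
    exact (ih _ (erase_ssubset hv)).add (even_two_mul _)

/-! ### Lovász's partition and the lower bounds -/

/-- The graph whose edges are the edges of `G` inside the classes of the colouring `c`. -/
def monoGraph {C : Type*} (G : SimpleGraph V) (c : V → C) : SimpleGraph V where
  Adj x y := G.Adj x y ∧ c x = c y
  symm := ⟨fun _ _ h => ⟨h.1.symm, h.2.symm⟩⟩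
  loopless := ⟨fun _ h => h.1.ne rfl⟩

/-- Lovász's partition lemma: a colouring with the fewest monochromatic edges has small
monochromatic degrees. -/
lemma exists_partition (G : SimpleGraph V) (U : Finset V) (k t : ℕ) (ht : 0 < t)
    (h : ∀ v ∈ U, degIn G U v < (k + 1) * t) :
    ∃ c : V → Fin t, ∀ v ∈ U, degIn (monoGraph G c) U v ≤ k := by
  have : Nonempty (Fin t) := ⟨⟨0, ht⟩⟩
  let Φ : (V → Fin t) → ℕ := fun c => ∑ x ∈ U, degIn (monoGraph G c) U x
  let c := Function.argmin Φ
  have hmin : ∀ c', Φ c ≤ Φ c' := fun c' => Function.argmin_le Φ c'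
  refine ⟨c, fun v hv => ?_⟩
  by_contra! hlt
  -- Pigeonhole: fewer than (k+1)t neighbours are spread over t colours.
  obtain ⟨j, hj⟩ : ∃ j : Fin t, #{w ∈ U.filter (G.Adj v) | c w = j} ≤ k := by
    by_contra! hcon
    have h1 : #(U.filter (G.Adj v)) = ∑ j : Fin t, #{w ∈ U.filter (G.Adj v) | c w = j} :=
      card_eq_sum_card_fiberwise fun _ _ => mem_coe.2 (mem_univ _)
    have h2 : ∑ j : Fin t, (k + 1) ≤ ∑ j : Fin t, #{w ∈ U.filter (G.Adj v) | c w = j} :=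
      sum_le_sum fun j _ => hcon j
    have h3 := h v hv
    simp only [sum_const, card_univ, Fintype.card_fin, smul_eq_mul] at h2
    rw [degIn, h1] at h3
    linarith [mul_comm t (k + 1)]
  -- Recolouring `v` with `j` changes only the edges at `v`, and would leave fewer of them
  -- monochromatic.
  have hm := hmin (Function.update c v j)
  simp only [Φ] at hm
  rw [sum_degIn_erase _ hv, sum_degIn_erase (monoGraph G (Function.update c v j)) hv] at hm
  have e1 : ∑ x ∈ U.erase v, degIn (monoGraph G (Function.update c v j)) (U.erase v) x =
      ∑ x ∈ U.erase v, degIn (monoGraph G c) (U.erase v) x := by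
    refine sum_congr rfl fun x hx => ?_
    unfold degIn
    congr 1
    refine filter_congr fun y hy => ?_
    simp only [monoGraph]
    rw [Function.update_of_ne (ne_of_mem_erase hx), Function.update_of_ne (ne_of_mem_erase hy)]
  have e2 : degIn (monoGraph G (Function.update c v j)) U v ≤ k := by
    refine le_trans (card_le_card fun w hw => ?_) hj
    simp only [monoGraph, mem_filter, Function.update_self] at hw ⊢
    rw [Function.update_of_ne hw.2.1.ne'] at hw
    exact ⟨⟨hw.1, hw.2.1⟩, hw.2.2.symm⟩
  omega

lemma exists_kIndep_of_degIn_lt (G : SimpleGraph V) (U : Finset V) (k t : ℕ) (ht : 0 < t)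
    (h : ∀ v ∈ U, degIn G U v < (k + 1) * t) :
    ∃ S ⊆ U, (∀ v ∈ S, degIn G S v ≤ k) ∧ #U ≤ t * #S := by
  obtain ⟨c, hc⟩ := exists_partition G U k t ht h
  have : Nonempty (Fin t) := ⟨⟨0, ht⟩⟩
  obtain ⟨j, -, hj⟩ := exists_max_image (univ : Finset (Fin t)) (fun j => #{w ∈ U | c w = j})
    univ_nonempty
  refine ⟨{w ∈ U | c w = j}, filter_subset _ _, fun v hv => ?_, ?_⟩
  · obtain ⟨hvU, hvj⟩ := mem_filter.1 hv
    refine le_trans (card_le_card fun w hw => ?_) (hc v hvU)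
    obtain ⟨hw, hadj⟩ := mem_filter.1 hw
    obtain ⟨hwU, hwj⟩ := mem_filter.1 hw
    exact mem_filter.2 ⟨hwU, hadj, hvj.trans hwj.symm⟩
  · have h1 : #U = ∑ j : Fin t, #{w ∈ U | c w = j} :=
      card_eq_sum_card_fiberwise fun _ _ => mem_coe.2 (mem_univ _)
    rw [h1]
    refine (sum_le_card_nsmul _ _ _ fun i _ => hj i (mem_univ i)).trans ?_
    simp

/-- A piecewise linear lower bound for the `k`-independence number. -/
lemma exists_kIndep (G : SimpleGraph V) (k t : ℕ) (ht : 1 ≤ t) (U : Finset V) :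
    ∃ S ⊆ U, (∀ v ∈ S, degIn G S v ≤ k) ∧
      2 * t * (k + 1) * #U ≤ t * (t + 1) * (k + 1) * #S + ∑ v ∈ U, degIn G U v := by
  induction t, ht using Nat.le_induction generalizing U with
  | base =>
    induction U using Finset.strongInduction with
    | H U ih =>
    by_cases h : ∃ v ∈ U, (k + 1) * 1 ≤ degIn G U v
    · obtain ⟨v, hv, hd⟩ := h
      obtain ⟨S, hSU, hS, hle⟩ := ih _ (erase_ssubset hv)
      refine ⟨S, hSU.trans (erase_subset _ _), hS, ?_⟩
      rw [sum_degIn_erase G hv, ← card_erase_add_one hv]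
      linarith
    · push Not at h
      obtain ⟨S, hSU, hS, hle⟩ := exists_kIndep_of_degIn_lt G U k 1 one_pos h
      refine ⟨S, hSU, hS, ?_⟩
      have := Nat.mul_le_mul_left (2 * (k + 1)) hle
      have := Nat.zero_le (∑ v ∈ U, degIn G U v)
      linarith
  | succ t ht iht =>
    induction U using Finset.strongInduction with
    | H U ih =>
    -- Deleting such a vertex lowers the degree sum by at least 2(k+1)(t+1), exactly what the left
    -- side loses.
    by_cases h : ∃ v ∈ U, (k + 1) * (t + 1) ≤ degIn G U v
    · obtain ⟨v, hv, hd⟩ := h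
      obtain ⟨S, hSU, hS, hle⟩ := ih _ (erase_ssubset hv)
      refine ⟨S, hSU.trans (erase_subset _ _), hS, ?_⟩
      rw [sum_degIn_erase G hv, ← card_erase_add_one hv]
      linarith
    · push Not at h
      -- The chords for t and t+1 cross at average degree t(k+1): above it the partition into t+1
      -- classes suffices, below it the chord for t is the stronger one.
      by_cases hs : t * (k + 1) * #U ≤ ∑ v ∈ U, degIn G U v
      · obtain ⟨S, hSU, hS, hle⟩ := exists_kIndep_of_degIn_lt G U k (t + 1) (Nat.succ_pos t) h
        refine ⟨S, hSU, hS, ?_⟩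
        have := Nat.mul_le_mul_left ((t + 2) * (k + 1)) hle
        linarith
      · push Not at hs
        obtain ⟨S, hSU, hS, hle⟩ := iht U
        refine ⟨S, hSU, hS, ?_⟩
        refine le_of_mul_le_mul_left (a := t) ?_ (by omega)
        have := Nat.mul_le_mul_left (t + 2) hle
        linarith

theorem le_f_of_tangent (k d t : ℕ) (ht : 1 ≤ t) :
    (2 * t * (k + 1) - d : ℝ) / (t * (t + 1) * (k + 1)) ≤ f k d := by
  refine le_f fun V _ _ G hG => ?_
  obtain ⟨S, -, hS, hle⟩ := exists_kIndep G k t ht univ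
  refine ⟨S, hS, ?_⟩
  have ht' : (0 : ℝ) < t := by exact_mod_cast ht
  rw [div_mul_eq_mul_div, div_le_iff₀ (by positivity)]
  rw [card_univ] at hle
  have h2 : (2 * t * (k + 1) * Fintype.card V : ℝ) ≤
      t * (t + 1) * (k + 1) * #S + d * Fintype.card V := by
    exact_mod_cast hle.trans (by gcongr)
  linarith

theorem div_le_f (k d : ℕ) : ((k : ℝ) + 1) / (d + k + 1) ≤ f k d := by
  -- This t satisfies t-1 ≤ d/(k+1) < t, so the chord is evaluated between its end points, where it
  -- lies above the convex curve.
  refine le_trans ?_ (le_f_of_tangent k d (d / (k + 1) + 1) (Nat.le_add_left _ _))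
  set t := d / (k + 1) + 1 with ht
  have h1 : d < t * (k + 1) := by
    rw [ht, mul_comm]; exact Nat.lt_mul_div_succ d (Nat.succ_pos k)
  have h2 : t * (k + 1) ≤ d + (k + 1) := by
    rw [ht, add_mul, one_mul]; exact Nat.add_le_add_right (Nat.div_mul_le_self d (k + 1)) _
  have h1' : (d : ℝ) ≤ t * (k + 1) := by exact_mod_cast h1.le
  have h2' : (t * (k + 1) : ℝ) ≤ d + (k + 1) := by exact_mod_cast h2
  have ht' : (0 : ℝ) < t := by exact_mod_cast Nat.succ_pos _
  rw [div_le_div_iff₀ (by positivity) (by positivity)]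
  nlinarith [mul_nonneg (sub_nonneg.2 h1') (sub_nonneg.2 h2')]

/-! ### Girth under insertion and deletion of edges -/

/-- Every cycle of `G` has more than `m + 1` edges: the ends of an edge `e` are at distance more
than `m` in `G - e`. -/
def GirthGT (m : ℕ) (G : SimpleGraph V) : Prop :=
  ∀ a b, G.Adj a b → (m : ℕ∞) < (G.deleteEdges {s(a, b)}).edist a b

lemma edist_le_add_one_of_adj (G : SimpleGraph V) {s s' : V} (h : G.Adj s s') (t : V) :
    G.edist s t ≤ G.edist s' t + 1 := by
  rw [add_comm, ← edist_eq_one_iff_adj.2 h]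
  exact SimpleGraph.edist_triangle

/-- A walk that uses the new edge several times can be shortcut to one that uses it at most once, in
one of the two directions. -/
lemma walk_sup_edge (G : SimpleGraph V) (a b : V) {s t : V} (p : (G ⊔ edge a b).Walk s t) :
    G.edist s t ≤ p.length ∨ G.edist s a + 1 + G.edist b t ≤ p.length ∨
      G.edist s b + 1 + G.edist a t ≤ p.length := by
  induction p with
  | nil => simp
  | @cons s s' t hadj p ih =>
    rw [Walk.length_cons, Nat.cast_add, Nat.cast_one]
    have mono {x : ℕ∞} (hx : x ≤ p.length) : x + 1 ≤ p.length + 1 := by gcongr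
    rw [sup_adj, edge_adj] at hadj
    rcases hadj with hadj | ⟨⟨rfl, rfl⟩ | ⟨rfl, rfl⟩, -⟩
    · have h := edist_le_add_one_of_adj G hadj
      rcases ih with ih | ih | ih
      · exact .inl ((h t).trans (mono ih))
      · refine .inr (.inl (le_trans ?_ (mono ih)))
        calc _ ≤ G.edist s' a + 1 + 1 + G.edist b t := by gcongr; exact h a
          _ = _ := by ring
      · refine .inr (.inr (le_trans ?_ (mono ih)))
        calc _ ≤ G.edist s' b + 1 + 1 + G.edist a t := by gcongr; exact h b
          _ = _ := by ring
    · rcases ih with ih | ih | ih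
      · refine .inr (.inl ?_)
        rw [edist_self, zero_add, add_comm]
        exact mono ih
      · refine .inr (.inl ?_)
        rw [edist_self, zero_add, add_comm]
        exact mono (le_trans le_add_self ih)
      · exact .inl ((le_trans le_add_self ih).trans le_self_add)
    · rcases ih with ih | ih | ih
      · refine .inr (.inr ?_)
        rw [edist_self, zero_add, add_comm]
        exact mono ih
      · exact .inl ((le_trans le_add_self ih).trans le_self_add)
      · refine .inr (.inr ?_)
        rw [edist_self, zero_add, add_comm]
        exact mono (le_trans le_add_self ih)

lemma lt_edist_sup_edge (G : SimpleGraph V) {a b s t : V} {m : ℕ} (h1 : m < G.edist s t)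
    (h2 : m < G.edist s a + 1 + G.edist b t) (h3 : m < G.edist s b + 1 + G.edist a t) :
    m < (G ⊔ edge a b).edist s t := by
  by_cases h : (G ⊔ edge a b).edist s t = ⊤
  · rw [h]; exact ENat.natCast_lt_top m
  · obtain ⟨p, hp⟩ := exists_walk_of_edist_ne_top h
    rw [← hp]
    rcases walk_sup_edge G a b p with h | h | h
    exacts [h1.trans_le h, h2.trans_le h, h3.trans_le h]

lemma GirthGT.mono {m : ℕ} {G H : SimpleGraph V} (h : GirthGT m G) (hle : H ≤ G) :
    GirthGT m H := fun a b hab =>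
  (h a b (hle hab)).trans_le (edist_anti (deleteEdges_mono hle))

/-- A new short cycle would pass through ab, and the rest of it would be a short walk from a to b in
`G`. For an old edge cd, a short detour through ab closes up with cd to such a walk. -/
lemma GirthGT.sup_edge {m : ℕ} {G : SimpleGraph V} (h : GirthGT m G) {a b : V}
    (hab : m < G.edist a b) : GirthGT m (G ⊔ edge a b) := by
  intro c d hcd
  by_cases he : s(c, d) = s(a, b)
  · have hle : (G ⊔ edge a b).deleteEdges {s(c, d)} ≤ G := by
      intro x y hxy
      rw [deleteEdges_adj, sup_adj, adj_edge, he, Set.mem_singleton_iff] at hxy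
      obtain ⟨h1 | h1, h2⟩ := hxy
      · exact h1
      · exact absurd h1.1.symm h2
    have : m < G.edist c d := by
      rcases Sym2.eq_iff.1 he with ⟨rfl, rfl⟩ | ⟨rfl, rfl⟩
      · exact hab
      · rwa [edist_comm]
    exact this.trans_le (edist_anti hle)
  · have hG : G.Adj c d := by
      rw [sup_adj, adj_edge] at hcd
      exact hcd.resolve_right fun h => he h.1.symm
    have hle : (G ⊔ edge a b).deleteEdges {s(c, d)} ≤ G.deleteEdges {s(c, d)} ⊔ edge a b := by
      intro x y hxy
      rw [deleteEdges_adj, sup_adj] at hxy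
      rw [sup_adj, deleteEdges_adj]
      tauto
    refine lt_of_lt_of_le ?_ (edist_anti hle)
    have hle' : G.deleteEdges {s(c, d)} ≤ G := deleteEdges_le _
    refine lt_edist_sup_edge _ (h c d hG) (hab.trans_le ?_) (hab.trans_le ?_)
    · calc G.edist a b ≤ G.edist a c + G.edist c b := SimpleGraph.edist_triangle
        _ ≤ G.edist a c + (G.edist d b + 1) := by
          gcongr; exact edist_le_add_one_of_adj G hG b
        _ = G.edist c a + 1 + G.edist b d := by
          rw [edist_comm (u := a), edist_comm (u := d)]; ring
        _ ≤ _ := by gcongr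
    · calc G.edist a b ≤ G.edist a d + G.edist d b := SimpleGraph.edist_triangle
        _ ≤ G.edist a d + (G.edist c b + 1) := by
          gcongr; exact edist_le_add_one_of_adj G hG.symm b
        _ = G.edist c b + 1 + G.edist a d := by ring
        _ ≤ _ := by gcongr

lemma exists_adj_edist_eq {G : SimpleGraph V} {u x : V} {i : ℕ} (h : G.edist u x = i + 1) :
    ∃ y, G.Adj x y ∧ G.edist u y ≤ i := by
  rw [edist_comm] at h
  obtain ⟨p, hp⟩ := exists_walk_of_edist_eq_coe (k := i + 1) (by exact_mod_cast h)
  cases p with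
  | nil => simp at hp
  | @cons _ y _ hadj q =>
    refine ⟨y, hadj, ?_⟩
    rw [edist_comm]
    refine (edist_le q).trans ?_
    rw [Walk.length_cons] at hp
    exact_mod_cast (Nat.succ.inj hp).le

lemma not_adj_of_lt_edist {G : SimpleGraph V} {a b : V} {m : ℕ} (hm : 1 ≤ m)
    (h : m < G.edist a b) : ¬ G.Adj a b ∧ a ≠ b := by
  have h1 : (1 : ℕ∞) < G.edist a b := lt_of_le_of_lt (by exact_mod_cast hm) h
  have := mt edist_le_one_iff_adj_or_eq.2 h1.not_ge
  tauto

/-! ### Regular graphs of large girth -/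

section Fintype

variable [Fintype V]

lemma degIn_sup_edge (G : SimpleGraph V) {a b : V} (hab : ¬ G.Adj a b) (hne : a ≠ b) (z : V) :
    degIn (G ⊔ edge a b) univ z =
      degIn G univ z + (if z = a then 1 else 0) + (if z = b then 1 else 0) := by
  have key : ∀ w, (G ⊔ edge a b).Adj z w ↔ G.Adj z w ∨ (z = a ∧ w = b ∨ z = b ∧ w = a) := by
    intro w
    rw [sup_adj, edge_adj]
    constructor
    · tauto
    · rintro (h | h)
      · exact .inl h
      · refine .inr ⟨h, ?_⟩
        rcases h with ⟨rfl, rfl⟩ | ⟨rfl, rfl⟩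
        exacts [hne, hne.symm]
  unfold degIn
  simp only [key]
  by_cases ha : z = a
  · subst ha
    have : ({w | G.Adj z w ∨ (z = z ∧ w = b ∨ z = b ∧ w = z)} : Finset V) =
        insert b ({w | G.Adj z w} : Finset V) := by
      ext w; simp [hne]; tauto
    rw [this, card_insert_of_notMem (by simpa using hab)]
    simp [hne]
  · by_cases hb : z = b
    · subst hb
      have : ({w | G.Adj z w ∨ (z = a ∧ w = z ∨ z = z ∧ w = a)} : Finset V) =
          insert a ({w | G.Adj z w} : Finset V) := by
        ext w; simp [ha]; tauto
      rw [this, card_insert_of_notMem (by simpa using fun h => hab (Adj.symm h))]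
      simp [ha]
    · simp [ha, hb]

lemma degIn_deleteEdges (G : SimpleGraph V) {a b : V} (hab : G.Adj a b) (z : V) :
    degIn G univ z = degIn (G.deleteEdges {s(a, b)}) univ z +
      (if z = a then 1 else 0) + (if z = b then 1 else 0) := by
  rw [← degIn_sup_edge _ (by simp [deleteEdges_adj]) hab.ne]
  congr 1
  ext x y
  rw [sup_adj, deleteEdges_adj, adj_edge, Set.mem_singleton_iff]
  constructor
  · intro h
    by_cases he : s(x, y) = s(a, b)
    · exact .inr ⟨he.symm, h.ne⟩
    · exact .inl ⟨h, he⟩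
  · rintro (h | ⟨h, -⟩)
    · exact h.1
    · exact (adj_congr_of_sym2 G h).1 hab

/-- Away from `u`, one of the at most s+1 neighbours of `x` leads back towards `u`; at `u` itself
the missing edge does the same service. Hence balls around a deficient vertex have at most 1 + s +
... + s^m vertices. -/
lemma card_forward_le {G : SimpleGraph V} {s : ℕ} {u : V} (hdeg : ∀ z, degIn G univ z ≤ s + 1)
    (hu : degIn G univ u ≤ s) {i : ℕ} {x : V} (hx : G.edist u x = i) :
    #{y | G.Adj x y ∧ i < G.edist u y} ≤ s := by
  cases i with
  | zero =>
    obtain rfl : u = x := by simpa using hx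
    exact (card_le_card fun y hy => by simp at hy ⊢; exact hy.1).trans hu
  | succ i =>
    obtain ⟨y, hxy, hy⟩ := exists_adj_edist_eq (i := i) (by exact_mod_cast hx)
    have : #{y | G.Adj x y ∧ (i + 1 : ℕ) < G.edist u y} < degIn G univ x := by
      refine card_lt_card ⟨fun z hz => ?_, fun hsub => ?_⟩
      · simp only [mem_filter, mem_univ, true_and] at hz ⊢
        exact hz.1
      · have := hsub (mem_filter.2 ⟨mem_univ y, hxy⟩)
        simp only [mem_filter, mem_univ, true_and] at this
        have h2 := this.2.trans_le hy
        exact absurd h2 (by norm_cast; omega)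
    have := hdeg x
    omega

lemma card_sphere_le {G : SimpleGraph V} {s : ℕ} {u : V} (hdeg : ∀ z, degIn G univ z ≤ s + 1)
    (hu : degIn G univ u ≤ s) (i : ℕ) : #{x | G.edist u x = i} ≤ s ^ i := by
  induction i with
  | zero =>
    have : ({x | G.edist u x = (0 : ℕ)} : Finset V) = {u} := by
      ext x
      rw [mem_filter, mem_singleton, Nat.cast_zero, edist_eq_zero_iff, eq_comm]
      simp
    rw [this]; simp
  | succ i ih =>
    have hsub : ({x | G.edist u x = (i + 1 : ℕ)} : Finset V) ⊆
        ({x | G.edist u x = i} : Finset V).biUnion fun x => {y | G.Adj x y ∧ i < G.edist u y} := by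
      intro y hy
      simp only [mem_filter, mem_univ, true_and, mem_biUnion] at hy ⊢
      obtain ⟨x, hyx, hx⟩ := exists_adj_edist_eq (i := i) (by exact_mod_cast hy)
      refine ⟨x, le_antisymm hx ?_, hyx.symm, ?_⟩
      · have := edist_le_add_one_of_adj G hyx u
        rw [SimpleGraph.edist_comm, hy, SimpleGraph.edist_comm, Nat.cast_add, Nat.cast_one] at this
        exact (ENat.add_le_add_iff_right ENat.one_ne_top).1 this
      · rw [hy]; norm_cast; omega
    calc _ ≤ _ := card_le_card hsub
      _ ≤ #({x | G.edist u x = i} : Finset V) * s :=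
        card_biUnion_le_card_mul _ _ _ fun x hx => card_forward_le hdeg hu (mem_filter.1 hx).2
      _ ≤ s ^ i * s := by gcongr
      _ = s ^ (i + 1) := (pow_succ _ _).symm

lemma card_closedBall_le {G : SimpleGraph V} {s : ℕ} {u : V}
    (hdeg : ∀ z, degIn G univ z ≤ s + 1) (hu : degIn G univ u ≤ s) (m : ℕ) :
    #{x | G.edist u x ≤ m} ≤ ∑ i ∈ range (m + 1), s ^ i := by
  have hsub : ({x | G.edist u x ≤ m} : Finset V) ⊆
      (range (m + 1)).biUnion fun i => {x | G.edist u x = i} := by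
    intro x hx
    simp only [mem_filter, mem_univ, true_and, mem_biUnion, mem_range] at hx ⊢
    obtain ⟨i, hi⟩ := ENat.ne_top_iff_exists.1 (ne_top_of_le_ne_top (ENat.natCast_ne_top m) hx)
    refine ⟨i, ?_, hi.symm⟩
    rw [← hi] at hx
    exact Nat.lt_succ_of_le (by exact_mod_cast hx)
  exact (card_le_card hsub).trans (card_biUnion_le.trans
    (sum_le_sum fun i _ => card_sphere_le hdeg hu i))

/-- An edge at which a switching with the deficient vertices `u` and `v` is possible. -/
lemma exists_adj_far {G : SimpleGraph V} {s m : ℕ} {u v : V}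
    (hcard : 2 * ∑ i ∈ range (m + 1), s ^ i ≤ Fintype.card V)
    (hdeg : ∀ z, degIn G univ z ≤ s + 1) (hu : degIn G univ u ≤ s) (hv : degIn G univ v ≤ s)
    (huv : G.edist u v ≤ m) (hfull : ∀ w, m < G.edist u w → degIn G univ w = s + 1) :
    ∃ w y, G.Adj w y ∧ m < G.edist u w ∧ m < G.edist v w ∧
      (m < G.edist v y ∨ m < G.edist u y) := by
  by_contra! hcon
  set Bu : Finset V := {x | G.edist u x ≤ m} with hBu
  set Bv : Finset V := {x | G.edist v x ≤ m} with hBv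
  set Z : Finset V := (Bu ∪ Bv)ᶜ with hZ
  set T : Finset V := {x | G.edist u x = m ∧ G.edist v x = m} with hT
  have memZ : ∀ w ∈ Z, m < G.edist u w ∧ m < G.edist v w := by
    intro w hw
    simpa [hZ, hBu, hBv] using hw
  have hTB : T ⊆ Bu ∩ Bv := by
    intro x hx
    simp only [hT, mem_filter, mem_univ, true_and] at hx
    simp [hBu, hBv, hx.1, hx.2]
  -- The two balls meet and together have at most as many vertices as the graph, with multiplicity,
  -- so the set `Z` outside both is at least as large as their intersection, hence nonempty.
  have hpos : 0 < #(Bu ∩ Bv) := card_pos.2 ⟨v, by simp [hBu, hBv, huv]⟩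
  have hZc : #(Bu ∩ Bv) ≤ #Z := by
    have h1 := card_union_add_card_inter Bu Bv
    have h2 := card_add_card_compl (Bu ∪ Bv)
    have h3 : #Bu ≤ _ := card_closedBall_le hdeg hu m
    have h4 : #Bv ≤ _ := card_closedBall_le hdeg hv m
    rw [← hZ] at h2
    omega
  -- Without a suitable edge, all s+1 neighbours of a vertex of `Z` are at distance exactly m from
  -- both `u` and `v`, while a vertex of `T` has at most s neighbours farther from `u`. As #T ≤ #Z,
  -- the double count is contradictory.
  have hcount : #Z * (s + 1) ≤ #T * s := by
    refine card_mul_le_card_mul G.Adj (fun w hw => ?_) fun x hx => ?_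
    · obtain ⟨h1, h2⟩ := memZ w hw
      rw [← hfull w h1]
      refine card_le_card fun y hy => ?_
      have hwy : G.Adj w y := (mem_filter.1 hy).2
      obtain ⟨h3, h4⟩ := hcon w y hwy h1 h2
      have close : ∀ x, m < G.edist x w → m ≤ G.edist x y := by
        intro x hx
        have := hx.trans_le (edist_comm.trans_le (edist_le_add_one_of_adj G hwy x))
        rw [edist_comm (u := y)] at this
        exact Order.le_of_lt_add_one this
      refine mem_filter.2 ⟨mem_filter.2 ⟨mem_univ _, ?_, ?_⟩, hwy⟩
      · exact le_antisymm h4 (close u h1)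
      · exact le_antisymm h3 (close v h2)
    · refine le_trans (card_le_card fun w hw => ?_)
        (card_forward_le hdeg hu (mem_filter.1 hx).2.1)
      obtain ⟨hw, hwx⟩ := mem_filter.1 hw
      exact mem_filter.2 ⟨mem_univ _, hwx.symm, (memZ w hw).1⟩
  have h5 := card_le_card hTB
  have h6 : #T * s ≤ #Z * s := Nat.mul_le_mul_right s (h5.trans hZc)
  rw [mul_add] at hcount
  omega

/-- The edge wy is replaced by uw and vy, which restores the degrees of `w` and `y`. A short path
from `v` to `y` through uw would have to join `w` to `y` without wy, against the girth, or `v` to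
`w`, which are far apart. The case u = v is allowed. -/
lemma exists_switch {G : SimpleGraph V} {m : ℕ} {u v w y : V} (hm : 1 ≤ m)
    (hG : GirthGT m G) (hwy : G.Adj w y) (huw : m < G.edist u w) (hvw : m < G.edist v w)
    (hvy : m < G.edist v y) :
    ∃ G' : SimpleGraph V, GirthGT m G' ∧ ∀ z, degIn G' univ z =
      degIn G univ z + (if z = u then 1 else 0) + (if z = v then 1 else 0) := by
  set G₁ := G.deleteEdges {s(w, y)} with hG₁
  have hle : G₁ ≤ G := deleteEdges_le _
  have huw₁ : m < G₁.edist u w := huw.trans_le (edist_anti hle)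
  have hvw₁ : m < G₁.edist v w := hvw.trans_le (edist_anti hle)
  have hvy₁ : m < G₁.edist v y := hvy.trans_le (edist_anti hle)
  have hG₂ : GirthGT m (G₁ ⊔ edge u w) := (hG.mono hle).sup_edge huw₁
  have hvy₂ : m < (G₁ ⊔ edge u w).edist v y := by
    refine lt_edist_sup_edge _ hvy₁ ((hG w y hwy).trans_le le_add_self) ?_
    exact hvw₁.trans_le (le_self_add.trans le_self_add)
  refine ⟨G₁ ⊔ edge u w ⊔ edge v y, hG₂.sup_edge hvy₂, fun z => ?_⟩
  obtain ⟨a1, a2⟩ := not_adj_of_lt_edist hm huw₁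
  obtain ⟨b1, b2⟩ := not_adj_of_lt_edist hm hvy₂
  rw [degIn_sup_edge _ b1 b2, degIn_sup_edge _ a1 a2, degIn_deleteEdges G hwy, ← hG₁]
  omega

/-- The hypothesis on degrees says that `u` and `v` are deficient or, if u = v, that two edges are
missing there. Deficient vertices far apart are joined; if there are none, all vertices far from `u`
have full degree and a switching is possible. -/
lemma exists_larger {G : SimpleGraph V} {s m : ℕ} {u v : V} (hm : 1 ≤ m)
    (hcard : 2 * ∑ i ∈ range (m + 1), s ^ i ≤ Fintype.card V) (hG : GirthGT m G)
    (hdeg : ∀ z, degIn G univ z + (if z = u then 1 else 0) + (if z = v then 1 else 0) ≤ s + 1) :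
    ∃ G' : SimpleGraph V, GirthGT m G' ∧ (∀ z, degIn G' univ z ≤ s + 1) ∧
      ∑ z, degIn G univ z < ∑ z, degIn G' univ z := by
  have hdeg' : ∀ z, degIn G univ z ≤ s + 1 := fun z => le_trans (by omega) (hdeg z)
  have hsum : ∀ (G' : SimpleGraph V) (a b : V), (∀ z, degIn G' univ z =
      degIn G univ z + (if z = a then 1 else 0) + (if z = b then 1 else 0)) →
      ∑ z, degIn G univ z < ∑ z, degIn G' univ z := by
    intro G' a b h
    refine sum_lt_sum (fun z _ => by rw [h]; omega) ⟨a, mem_univ a, by rw [h, if_pos rfl]; omega⟩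
  by_cases hfar : ∃ a b, degIn G univ a ≤ s ∧ degIn G univ b ≤ s ∧ m < G.edist a b
  · obtain ⟨a, b, ha, hb, hab⟩ := hfar
    obtain ⟨h1, h2⟩ := not_adj_of_lt_edist hm hab
    have h := degIn_sup_edge G h1 h2
    refine ⟨G ⊔ edge a b, hG.sup_edge hab, fun z => ?_, hsum _ a b h⟩
    rw [h]
    have := hdeg' z
    split_ifs with h3 h4 h4
    · exact absurd (h3.symm.trans h4) h2
    · subst h3; omega
    · subst h4; omega
    · omega
  · push Not at hfar
    have hu : degIn G univ u ≤ s := by have := hdeg u; rw [if_pos rfl] at this; omega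
    have hv : degIn G univ v ≤ s := by have := hdeg v; rw [if_pos (rfl : v = v)] at this; omega
    obtain ⟨w, y, hwy, huw, hvw, h⟩ := exists_adj_far hcard hdeg' hu hv (hfar u v hu hv)
      fun w hw => le_antisymm (hdeg' w) (by
        by_contra! hlt
        exact absurd hw (hfar u w hu (by omega)).not_gt)
    rcases h with h | h
    · obtain ⟨G', h1, h2⟩ := exists_switch hm hG hwy huw hvw h
      exact ⟨G', h1, fun z => (h2 z).trans_le (hdeg z), hsum _ u v h2⟩
    · obtain ⟨G', h1, h2⟩ := exists_switch hm hG hwy hvw huw h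
      refine ⟨G', h1, fun z => (h2 z).trans_le ?_, hsum _ v u h2⟩
      have := hdeg z
      omega

variable (V) in
/-- The theorem of Erdős and Sachs on regular graphs of large girth. -/
theorem exists_regular_girthGT (m s : ℕ) (hm : 1 ≤ m)
    (hcard : 2 * ∑ i ∈ range (m + 1), s ^ i ≤ Fintype.card V)
    (heven : Even (Fintype.card V * (s + 1))) :
    ∃ G : SimpleGraph V, GirthGT m G ∧ ∀ z, degIn G univ z = s + 1 := by
  obtain ⟨G, hmem, hmax⟩ := exists_max_image
    (univ.filter fun G : SimpleGraph V => GirthGT m G ∧ ∀ z, degIn G univ z ≤ s + 1)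
    (fun G => ∑ z, degIn G univ z)
    ⟨⊥, mem_filter.2 ⟨mem_univ _, fun a b h => h.elim, fun z => by simp [degIn]⟩⟩
  obtain ⟨-, hG, hdeg⟩ := mem_filter.1 hmem
  refine ⟨G, hG, ?_⟩
  by_contra! hne
  obtain ⟨u, hu⟩ := hne
  have hu' := hdeg u
  obtain ⟨v, hv⟩ : ∃ v, ∀ z,
      degIn G univ z + (if z = u then 1 else 0) + (if z = v then 1 else 0) ≤ s + 1 := by
    by_cases h : ∃ v, v ≠ u ∧ degIn G univ v ≤ s
    · obtain ⟨v, hvu, hv⟩ := h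
      refine ⟨v, fun z => ?_⟩
      have := hdeg z
      split_ifs with h1 h2 h2
      · exact absurd (h2.symm.trans h1) hvu
      · subst h1; omega
      · subst h2; omega
      · omega
    · push Not at h
      refine ⟨u, fun z => ?_⟩
      have hz := hdeg z
      split_ifs with h1
      · subst h1
        -- If only one vertex is deficient, the handshake lemma makes its deficiency even, hence at
        -- least two.
        have hrest : ∑ x ∈ univ.erase z, degIn G univ x = ∑ x ∈ univ.erase z, (s + 1) :=
          sum_congr rfl fun x hx => le_antisymm (hdeg x) (h x (ne_of_mem_erase hx))
        have h1 := add_sum_erase (univ : Finset V) (fun x => degIn G univ x) (mem_univ z)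
        have h2 := add_sum_erase (univ : Finset V) (fun _ : V => s + 1) (mem_univ z)
        simp only [hrest] at h1
        rw [sum_const (s + 1) (s := univ), card_univ, smul_eq_mul] at h2
        obtain ⟨e, he⟩ := even_sum_degIn G univ
        obtain ⟨e', he'⟩ := heven
        omega
      · omega
  obtain ⟨G', h1, h2, h3⟩ := exists_larger hm hcard hG hv
  exact absurd (hmax G' (mem_filter.2 ⟨mem_univ _, h1, h2⟩)) h3.not_ge

end Fintype

/-! ### Upper bounds from complements of regular graphs -/

/-- In a forest the end of a longest path has at most one neighbour, so minimum degree 2 forces an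
edge that is not a bridge. A path around it has more than m edges, hence at least m+2 vertices. -/
lemma card_gt_of_girthGT {V : Type*} {G : SimpleGraph V} {m : ℕ} (hG : GirthGT m G)
    {S : Finset V} (hne : S.Nonempty) (hdeg : ∀ v ∈ S, 2 ≤ degIn G S v) : m + 2 ≤ #S := by
  set H := G.induce (S : Set V) with hH
  have hcycle : ¬ H.IsAcyclic := by
    intro hac
    have : Nonempty (S : Set V) := hne.to_subtype
    obtain ⟨u, v, p, hp, hmax⟩ := Walk.exists_isPath_forall_isPath_length_le_length H
    have hsub : ∀ w, H.Adj u w → w = p.snd := by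
      intro w hw
      refine hac.eq_snd_of_adj_start hp hw ?_
      by_contra hns
      have := hmax _ _ _ (hp.cons (h := hw.symm) hns)
      rw [Walk.length_cons] at this
      omega
    have hle : degIn G S u ≤ 1 := by
      refine card_le_one.2 fun a ha b hb => ?_
      rw [mem_filter] at ha hb
      have h1 := hsub ⟨a, ha.1⟩ ha.2
      have h2 := hsub ⟨b, hb.1⟩ hb.2
      exact congrArg Subtype.val (h1.trans h2.symm)
    have := hdeg u u.2
    omega
  rw [isAcyclic_iff_forall_adj_isBridge] at hcycle
  push Not at hcycle
  obtain ⟨a, b, hab, hbr⟩ := hcycle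
  rw [isBridge_iff, not_not] at hbr
  obtain ⟨p, hp⟩ := hbr.exists_isPath
  have hlen := hp.length_lt
  rw [← Nat.card_eq_fintype_card, Nat.card_coe_set_eq, Set.ncard_coe_finset] at hlen
  let φ : H.deleteEdges {s(a, b)} →g G.deleteEdges {s((a : V), (b : V))} :=
    ⟨Subtype.val, by
      intro x y hxy
      rw [deleteEdges_adj, Set.mem_singleton_iff] at hxy ⊢
      refine ⟨hxy.1, fun h => hxy.2 ?_⟩
      rw [Sym2.eq_iff] at h ⊢
      simpa only [Subtype.ext_iff] using h⟩
  have h := (hG a b hab).trans_le (edist_le (p.map φ))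
  rw [Walk.length_map] at h
  have : m < p.length := by exact_mod_cast h
  omega

lemma degIn_compl_add {V : Type*} (H : SimpleGraph V) {S : Finset V} {v : V} (hv : v ∈ S) :
    degIn Hᶜ S v + degIn H S v + 1 = #S := by
  obtain ⟨T, hT, hmem⟩ := exists_card_eq_degIn H S v
  have hTS : T ⊆ S.erase v := fun w hw =>
    mem_erase.2 ⟨((hmem w).1 hw).2.ne', ((hmem w).1 hw).1⟩
  rw [hT, degIn_eq_card Hᶜ S v (S.erase v \ T), card_sdiff_add_card_eq_card hTS,
    card_erase_add_one hv]
  intro w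
  rw [mem_sdiff, mem_erase, hmem, compl_adj, ne_comm]
  tauto

/-- The bound on `f` given by the complement of an `r`-regular graph. -/
lemma f_le_of_regular {V : Type} [Fintype V] (H : SimpleGraph V) {k d r a : ℕ}
    (hcard : Fintype.card V = d + r + 1) (hr : ∀ v, degIn H univ v = r)
    (h : ∀ S : Finset V, #S = a + 1 → ¬ ∀ v ∈ S, a ≤ degIn H S v + k) :
    f k d ≤ (a : ℝ) / (d + r + 1) := by
  have : Nonempty V := Fintype.card_pos_iff.1 (by omega)
  have hc : ((d : ℝ) + r + 1) = Fintype.card V := by rw [hcard]; push_cast; ring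
  rw [hc]
  refine f_le Hᶜ ?_ fun S hS => ?_
  · rw [mul_comm, ← smul_eq_mul, ← card_univ]
    refine sum_le_card_nsmul _ _ _ fun v _ => ?_
    have := degIn_compl_add H (mem_univ v)
    rw [hr, card_univ, hcard] at this
    omega
  · by_contra! hlt
    obtain ⟨T, hTS, hT⟩ := exists_subset_card_eq (Nat.succ_le_of_lt hlt)
    refine h T hT fun v hv => ?_
    have h1 := degIn_compl_add H hv
    have h2 := (degIn_mono Hᶜ hTS v).trans (hS v (hTS hv))
    omega

/-- H is a perfect matching on d+2 vertices. A bad set of k+2 vertices would be a union of matching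
edges, but k+2 is odd. -/
theorem f_le_of_even_of_odd {k d : ℕ} (hd : Even d) (hk : Odd k) :
    f k d ≤ ((k : ℝ) + 1) / (d + 2) := by
  obtain ⟨H, -, hH⟩ := exists_regular_girthGT (Fin (d + 2)) 1 0 le_rfl
    (by simp [sum_range_succ]) (by simpa using hd.add even_two)
  have := f_le_of_regular H (k := k) (d := d) (r := 1) (a := k + 1) (by simp) hH
    (by
      intro S hS hdeg
      have h1 : ∀ v ∈ S, degIn H S v = 1 := fun v hv => by
        have h2 := hdeg v hv
        have h3 := (degIn_mono H (subset_univ S) v).trans_eq (hH v)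
        omega
      have h4 := even_sum_degIn H S
      rw [sum_congr rfl h1, sum_const, hS, smul_eq_mul, mul_one] at h4
      obtain ⟨a, ha⟩ := h4
      obtain ⟨b, hb⟩ := hk
      omega)
  convert this using 1
  push_cast
  ring

theorem f_le_of_cycle {k d : ℕ} (hkd : k < d) : f k d ≤ ((k : ℝ) + 2) / (d + 3) := by
  have hdeg2 : ∀ v, degIn (cycleGraph (d + 3)) univ v = 2 := fun v => by
    rw [← cycleGraph_degree_three_le (v := v), ← card_neighborFinset_eq_degree,
      neighborFinset_eq_filter, degIn]
    congr
  have := f_le_of_regular (cycleGraph (d + 3)) (k := k) (d := d) (r := 2) (a := k + 2) (by simp)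
    hdeg2
    (by
      intro S hS hdeg
      -- Inner degree 2 puts both cycle neighbours in `S`, so `S` is the whole cycle; but k+3 < d+3.
      have hclosed : ∀ v ∈ S, v + 1 ∈ S := fun v hv => by
        have h1 := hdeg v hv
        obtain ⟨T, hT, hTm⟩ := exists_card_eq_degIn (cycleGraph (d + 3)) S v
        obtain ⟨N, hN, hNm⟩ := exists_card_eq_degIn (cycleGraph (d + 3)) univ v
        have hsub : T ⊆ N := fun w hw => (hNm w).2 ⟨mem_univ w, ((hTm w).1 hw).2⟩
        have h2 : T = N := eq_of_subset_of_card_le hsub (by rw [← hN, hdeg2]; omega)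
        have h3 : v + 1 ∈ N := (hNm _).2 ⟨mem_univ _, by simp [cycleGraph_adj]⟩
        rw [← h2, hTm] at h3
        exact h3.1
      obtain ⟨v, hv⟩ : S.Nonempty := card_pos.1 (by omega)
      have hall : ∀ n : ℕ, v + Fin.ofNat (d + 3) n ∈ S := fun n => by
        induction n with
        | zero => simpa using hv
        | succ n ih =>
          have : Fin.ofNat (d + 3) (n + 1) = Fin.ofNat (d + 3) n + 1 := by
            ext; simp [Fin.val_add]
          rw [this, ← add_assoc]
          exact hclosed _ ih
      have huniv : S = univ := by
        refine eq_univ_iff_forall.2 fun w => ?_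
        have := hall (w - v).val
        rwa [Fin.ofNat_val_eq_self, add_sub_cancel] at this
      rw [huniv, card_univ, Fintype.card_fin] at hS
      omega)
  convert this using 1
  push_cast
  ring

/-- A set of k+3 vertices with inner degrees at least 2 would contain a cycle of length at most k+3,
so `GirthGT (k + 2)` is what is needed. -/
theorem f_le_of_girth {k d s : ℕ}
    (hcard : 2 * ∑ i ∈ range (k + 3), s ^ i ≤ d + (s + 1) + 1)
    (heven : Even ((d + (s + 1) + 1) * (s + 1))) :
    f k d ≤ ((k : ℝ) + 2) / (d + (s + 1) + 1) := by
  obtain ⟨H, hG, hH⟩ := exists_regular_girthGT (Fin (d + (s + 1) + 1)) (k + 2) s (by omega)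
    (by simpa using hcard) (by simpa using heven)
  have := f_le_of_regular H (k := k) (d := d) (r := s + 1) (a := k + 2) (by simp) hH
    (by
      intro S hS hdeg
      have := card_gt_of_girthGT hG (card_pos.1 (by omega : 0 < #S))
        fun v hv => by have := hdeg v hv; omega
      omega)
  convert this using 1
  push_cast
  ring

/-! ### Upper bounds from disjoint unions -/

/-- Some graph has `n` vertices, degree sum `s`, and no `k`-independent set of more than `a`
vertices. -/
def Realizes (k n s a : ℕ) : Prop :=
  ∃ (V : Type) (_ : Fintype V) (G : SimpleGraph V), Fintype.card V = n ∧
    ∑ v, degIn G univ v = s ∧ ∀ S : Finset V, (∀ v ∈ S, degIn G S v ≤ k) → #S ≤ a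

lemma Realizes.f_le {k n s a d : ℕ} (h : Realizes k n s a) (hn : 0 < n) (hs : s ≤ d * n) :
    f k d ≤ (a : ℝ) / n := by
  obtain ⟨V, _, G, rfl, rfl, hS⟩ := h
  have : Nonempty V := Fintype.card_pos_iff.1 hn
  exact KIndependence.f_le G hs hS

lemma realizes_zero (k : ℕ) : Realizes k 0 0 0 :=
  ⟨Empty, inferInstance, ⊥, by simp, by simp, fun S _ => by simp [eq_empty_of_isEmpty S]⟩

lemma degIn_disjSum_inl {V W : Type*} (G : SimpleGraph V) (H : SimpleGraph W)
    (S : Finset V) (T : Finset W) (v : V) :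
    degIn (G ⊕g H) (S.disjSum T) (.inl v) = degIn G S v := by
  unfold degIn
  rw [← card_map (Function.Embedding.inl : V ↪ V ⊕ W)]
  congr 1
  ext x
  cases x <;> simp

lemma degIn_disjSum_inr {V W : Type*} (G : SimpleGraph V) (H : SimpleGraph W)
    (S : Finset V) (T : Finset W) (w : W) :
    degIn (G ⊕g H) (S.disjSum T) (.inr w) = degIn H T w := by
  unfold degIn
  rw [← card_map (Function.Embedding.inr : W ↪ V ⊕ W)]
  congr 1
  ext x
  cases x <;> simp

lemma Realizes.add {k n s a n' s' a' : ℕ} (h : Realizes k n s a) (h' : Realizes k n' s' a') :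
    Realizes k (n + n') (s + s') (a + a') := by
  obtain ⟨V, _, G, rfl, rfl, hG⟩ := h
  obtain ⟨W, _, H, rfl, rfl, hH⟩ := h'
  refine ⟨V ⊕ W, inferInstance, G ⊕g H, Fintype.card_sum, ?_, fun S hS => ?_⟩
  · rw [Fintype.sum_sum_type, ← univ_disjSum_univ]
    simp only [degIn_disjSum_inl, degIn_disjSum_inr]
  · have hSe : S = S.toLeft.disjSum S.toRight := (toLeft_disjSum_toRight (u := S)).symm
    rw [← card_toLeft_add_card_toRight (u := S)]
    refine add_le_add (hG _ fun v hv => ?_) (hH _ fun w hw => ?_)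
    · rw [← degIn_disjSum_inl G H _ S.toRight, ← hSe]
      exact hS _ (mem_toLeft.1 hv)
    · rw [← degIn_disjSum_inr G H S.toLeft, ← hSe]
      exact hS _ (mem_toRight.1 hw)

lemma Realizes.nsmul {k n s a : ℕ} (h : Realizes k n s a) (q : ℕ) :
    Realizes k (q * n) (q * s) (q * a) := by
  induction q with
  | zero => simpa using realizes_zero k
  | succ q ih => simpa only [add_mul, one_mul] using ih.add h

/-- The join of a complete graph on `s` vertices and `t ≤ k + 1` isolated vertices. -/
lemma realizes_completeSplit (k s t : ℕ) (ht : t ≤ k + 1) :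
    Realizes k (s + t) (s * (s + t - 1) + t * s) (k + 1) := by
  let G : SimpleGraph (Fin s ⊕ Fin t) :=
    { Adj := fun x y => x ≠ y ∧ (x.isLeft ∨ y.isLeft)
      symm := ⟨fun _ _ h => ⟨h.1.symm, h.2.symm⟩⟩
      loopless := ⟨fun _ h => h.1 rfl⟩ }
  have hl : ∀ (S : Finset (Fin s ⊕ Fin t)) (i : Fin s), .inl i ∈ S →
      degIn G S (.inl i) = #S - 1 := by
    intro S i hi
    rw [← card_erase_of_mem hi, degIn]
    congr 1
    ext w
    simp only [G, mem_filter, mem_erase, Sum.isLeft_inl, true_or, and_true, ne_comm (b := w)]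
    exact and_comm
  refine ⟨Fin s ⊕ Fin t, inferInstance, G, by simp, ?_, fun S hS => ?_⟩
  · rw [Fintype.sum_sum_type]
    congr 1
    · simp [hl _ _ (mem_univ _)]
    · have : ∀ j : Fin t, degIn G univ (.inr j) = s := by
        intro j
        rw [degIn_eq_card G univ (.inr j) (univ.map Function.Embedding.inl), card_map, card_univ,
          Fintype.card_fin]
        rintro (x | x) <;> simp [G]
      simp [this]
  -- More than k+1 ≥ t vertices must include one from the clique, and it is adjacent to all the
  -- others.
  · by_contra! hlt
    obtain ⟨i, hi⟩ : ∃ i : Fin s, .inl i ∈ S := by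
      by_contra! hno
      have hsub : S ⊆ univ.map Function.Embedding.inr := by
        rintro (x | x) hx
        · exact absurd hx (hno x)
        · simp
      have := card_le_card hsub
      simp at this
      omega
    have := hS _ hi
    rw [hl S i hi] at this
    omega

theorem f_le_of_complete (k d : ℕ) : f k d ≤ ((k : ℝ) + 1) / (d + 1) := by
  have := (realizes_completeSplit k (d + 1) 0 (by omega)).f_le (d := d) (by omega)
    (by simp [mul_comm])
  convert this using 1
  push_cast
  ring

/-- Against average degree d, the component with d-1 clique vertices has degree excess d-4, and each
of the q components with d-2 clique vertices saves 6. This is where d ≤ 4 + 6q comes from. -/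
theorem f_two_le {d q : ℕ} (hd : 2 ≤ d) (hq : d ≤ 4 + 6 * q) :
    f 2 d ≤ 3 / ((d : ℝ) + 1 + 1 / ((q : ℝ) + 1)) := by
  obtain ⟨e, rfl⟩ := Nat.exists_eq_add_of_le' hd
  have := ((realizes_completeSplit 2 (e + 1) 3 le_rfl).add
    ((realizes_completeSplit 2 e 3 le_rfl).nsmul q)).f_le (d := e + 2) (by omega) (by
      have h1 : e + 1 + 3 - 1 = e + 3 := by omega
      have h2 : e + 3 - 1 = e + 2 := by omega
      rw [h1, h2]
      nlinarith)
  refine this.trans_eq ?_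
  push_cast
  rw [div_eq_div_iff (by positivity) (by positivity)]
  field_simp
  ring

/-- Each of the k stars saves 2 in the degree sum, which pays exactly for the excess 2k of the
component with two clique vertices. -/
theorem f_two_right_le (k : ℕ) :
    f k 2 ≤ ((k : ℝ) + 1) / ((k : ℝ) + 2 + 1 / ((k : ℝ) + 1)) := by
  have := (((realizes_completeSplit k 1 (k + 1) le_rfl).nsmul k).add
    (realizes_completeSplit k 2 (k + 1) le_rfl)).f_le (d := 2) (by omega) (by
      have h1 : 1 + (k + 1) - 1 = k + 1 := by omega
      have h2 : 2 + (k + 1) - 1 = k + 2 := by omega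
      rw [h1, h2]
      nlinarith)
  refine this.trans_eq ?_
  push_cast
  rw [div_eq_div_iff (by positivity) (by positivity)]
  field_simp
  ring

/-! ### The asymptotic upper bound and the final assembly -/

theorem f_le_one (k d : ℕ) : f k d ≤ 1 := by
  have := KIndependence.f_le (⊥ : SimpleGraph PUnit) (k := k) (d := d) (a := 1)
    (by simp [degIn]) fun S _ => card_le_one_of_subsingleton S
  simpa using this

theorem f_lt_rpow (k d : ℕ) : f k d <
    ((k : ℝ) + 2) / ((d : ℝ) + 1 / 4 * ((d : ℝ) / 2) ^ ((1 : ℝ) / ((k : ℝ) + 2)) + 1) := by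
  set y : ℝ := ((d : ℝ) / 2) ^ ((1 : ℝ) / ((k : ℝ) + 2)) with hy
  have hy0 : 0 ≤ y := by positivity
  have hpos : 0 < (d : ℝ) + 1 / 4 * y + 1 := by positivity
  -- For y < 2 the extra term y/4 is below 1/2, and the trivial bounds on `f` suffice.
  by_cases hy2 : y < 2
  · rw [lt_div_iff₀ hpos]
    by_cases hkd : k ≤ d
    · have hkd' : (k : ℝ) ≤ d := by exact_mod_cast hkd
      have h1 := f_le_of_complete k d
      rw [le_div_iff₀ (by positivity)] at h1
      have h2 := f_le_one k d
      have h3 : f k d * (1 / 4 * y) ≤ 1 * (1 / 4 * y) := by gcongr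
      nlinarith
    · have hkd' : (d : ℝ) + 1 ≤ k := by exact_mod_cast not_le.1 hkd
      have h2 := f_le_one k d
      have h3 := mul_le_mul_of_nonneg_right h2 hpos.le
      linarith
  · push Not at hy2
    set N := ⌊y / 2⌋₊ with hN
    have hN1 : 1 ≤ N := Nat.le_floor (by push_cast; linarith)
    have hNle : (N : ℝ) ≤ y / 2 := Nat.floor_le (by linarith)
    have hNlt : y / 2 < N + 1 := Nat.lt_floor_add_one _
    -- The degree s+1 = 2N is even, so the parity condition is automatic. It is at most y, so that
    -- 2(s+1)^(k+2) ≤ d, and exceeds y/4.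
    obtain ⟨s, hs⟩ : ∃ s, 2 * N = s + 1 := ⟨2 * N - 1, by omega⟩
    have hs' : (2 * N : ℝ) = s + 1 := by exact_mod_cast hs
    have hypow : y ^ (k + 2) = d / 2 := by
      rw [hy, ← Real.rpow_natCast, ← Real.rpow_mul (by positivity)]
      push_cast
      rw [one_div, inv_mul_cancel₀ (by positivity), Real.rpow_one]
    have hgeom : ∑ i ∈ range (k + 3), s ^ i ≤ (s + 1) ^ (k + 2) := by
      rw [add_pow]
      refine sum_le_sum fun i hi => ?_
      have := Nat.choose_pos (Nat.lt_succ_iff.1 (mem_range.1 hi))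
      rw [one_pow, mul_one]
      exact Nat.le_mul_of_pos_right _ this
    have hd : 2 * (s + 1) ^ (k + 2) ≤ d := by
      have h1 : ((s : ℝ) + 1) ^ (k + 2) ≤ y ^ (k + 2) := by
        gcongr
        linarith
      have h2 : (2 * (s + 1) ^ (k + 2) : ℝ) ≤ d := by linarith
      exact_mod_cast h2
    refine (f_le_of_girth (k := k) (d := d) (s := s) (by omega)
      (Even.mul_left (hs ▸ even_two_mul N) _)).trans_lt ?_
    have hN1' : (1 : ℝ) ≤ N := by exact_mod_cast hN1
    gcongr
    linarith

end KIndependence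

end

theorem mainTheorem3 :
    -- (1)
    (∀ k d : ℕ, k ≤ d →
      ((k : ℝ) + 1) / ((d : ℝ) + k + 1) ≤ KIndependence.f k d ∧
      KIndependence.f k d ≤ ((k : ℝ) + 1) / ((d : ℝ) + 1)) ∧
    -- (2)
    (∀ k d : ℕ, k < d → Even d → Odd k →
      KIndependence.f k d ≤ ((k : ℝ) + 1) / ((d : ℝ) + 2)) ∧
    -- (3)
    (∀ k d : ℕ, k < d →
      KIndependence.f k d ≤ ((k : ℝ) + 2) / ((d : ℝ) + 3)) ∧
    -- (4)
    (∀ k d : ℕ, 3 ≤ k → 2 * KIndependence.h k - (k : ℝ) - 1 ≤ (d : ℝ) → Even (d + k + 1) →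
      KIndependence.f k d ≤ ((k : ℝ) + 2) / ((d : ℝ) + k + 1)) ∧
    -- (5)
    (∀ d q : ℕ, 2 ≤ d → d ≤ 4 + 6 * q →
      3 / ((d : ℝ) + 3) ≤ KIndependence.f 2 d ∧
      KIndependence.f 2 d ≤ 3 / ((d : ℝ) + 1 + 1 / ((q : ℝ) + 1))) ∧
    -- (6)
    (∀ k : ℕ, 2 ≤ k →
      (k : ℝ) / ((k : ℝ) + 1) ≤ KIndependence.f k 2 ∧
      KIndependence.f k 2 ≤ ((k : ℝ) + 1) / ((k : ℝ) + 2 + 1 / ((k : ℝ) + 1))) ∧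
    -- (7)
    (∀ k : ℕ, 3 ≤ k → ∃ c : ℝ, 0 < c ∧ ∀ d : ℕ,
      KIndependence.f k d <
        ((k : ℝ) + 2) / ((d : ℝ) + c * ((d : ℝ) / 2) ^ ((1 : ℝ) / ((k : ℝ) + 2)) + 1)) := by
  refine ⟨fun k d _ => ⟨KIndependence.div_le_f k d, KIndependence.f_le_of_complete k d⟩,
    fun k d _ => KIndependence.f_le_of_even_of_odd, fun k d => KIndependence.f_le_of_cycle,
    fun k d hk hd heven => ?_, fun d q hd hq => ⟨?_, KIndependence.f_two_le hd hq⟩,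
    fun k hk => ⟨?_, KIndependence.f_two_right_le k⟩,
    fun k _ => ⟨1 / 4, by norm_num, KIndependence.f_lt_rpow k⟩⟩
  · obtain ⟨s, rfl⟩ := Nat.exists_eq_add_of_le' (by omega : 1 ≤ k)
    have hs : (2 : ℝ) ≤ s := by exact_mod_cast (by omega : 2 ≤ s)
    -- h(k) is the geometric sum that bounds a ball of radius k+2 in the girth construction with
    -- degree k = s+1.
    have hh : KIndependence.h (s + 1) = ∑ i ∈ Finset.range (s + 1 + 3), (s : ℝ) ^ i := by
      rw [geom_sum_eq (by linarith), KIndependence.h]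
      push_cast
      congr 1 <;> ring
    rw [hh] at hd
    have hcard : 2 * ∑ i ∈ Finset.range (s + 1 + 3), s ^ i ≤ d + (s + 1) + 1 := by
      have : (2 * ∑ i ∈ Finset.range (s + 1 + 3), (s : ℝ) ^ i) ≤ d + (s + 1) + 1 := by
        push_cast at hd
        linarith
      exact_mod_cast this
    have := KIndependence.f_le_of_girth (k := s + 1) hcard (heven.mul_right _)
    push_cast at this ⊢
    exact this
  · have := KIndependence.div_le_f 2 d
    convert this using 1
    push_cast
    ring
  -- The chord with t = 1 at d = 2 has value k/(k+1).
  · have := KIndependence.le_f_of_tangent k 2 1 le_rfl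
    refine le_of_eq_of_le ?_ this
    push_cast
    rw [div_eq_div_iff (by positivity) (by positivity)]
    ring
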